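/- For a domain $\Omega\subset\mathbb C^n$ and a finite set $S=\{a_1,\dots,a_N\}\subset\Omega$ of $N$ distinct points, define for $z\in\Omega$ the pluricomplex Green function with logarithmic poles at $S$, $$G_S(z):=\sup\{u(z): u \text{ plurisubharmonic on } \Omega,\ u\le 0,\ \text{and for each } j \text{ there is } C_j\in\mathbb R \text{ with } u(w)\le\log\|w-a_j\|+C_j \text{ for all } w\in\Omega\},$$ and Coman's Lempert function $$\ell_S(z):=\inf\Big\{\sum_{j=1}^N\log|\zeta_j| : \zeta_1,\dots,\zeta_N\in\mathbb D,\ \text{there is a holomorphic } \varphi:\mathbb D\to\Omega \text{ with } \varphi(0)=z,\ \varphi(\zeta_j)=a_j\ (j=1,\dots,N)\Big\},$$ where $\mathbb D$ is the unit disk of $\mathbb C$, $\log 0=-\infty$, and both functions take values in $[-\infty,\infty]$. Theorem. Let $\Omega=\mathbb B^2$ be the open Euclidean unit ball of $\mathbb C^2$. There exist a set $S\subset\mathbb B^2$ of exactly three points and a point $z\in\mathbb B^2$ such that $\ell_S(z)>G_S(z)$. -/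

import Mathlib

open Set Metric MeasureTheory

noncomputable section

/-- The mean `(1 / 2π) ∫₀^{2π} f θ dθ` of a function with values in `[-∞, ∞]`, as the mean of its
positive part minus the mean of its negative part. It is used only for functions that are bounded
above, where no difference `∞ - ∞` occurs and the mean may be `-∞`. -/
def circleMean (f : ℝ → EReal) : EReal :=
  (((∫⁻ θ in Ioc (0 : ℝ) (2 * Real.pi), (f θ).toENNReal) / ENNReal.ofReal (2 * Real.pi) :
      ENNReal) : EReal) -
    (((∫⁻ θ in Ioc (0 : ℝ) (2 * Real.pi), (-f θ).toENNReal) / ENNReal.ofReal (2 * Real.pi) :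
      ENNReal) : EReal)

/-- `u` is plurisubharmonic on the open set `Ω`: it takes values in `[-∞, ∞)`, is upper
semicontinuous, and satisfies the sub-mean value inequality on the boundary circle of every closed
affine complex disk contained in `Ω`. The constant `-∞` is allowed; this does not affect suprema
taken in `[-∞, ∞]`. -/
structure PlurisubharmonicOn {E : Type*} [NormedAddCommGroup E] [NormedSpace ℂ E]
    (u : E → EReal) (Ω : Set E) : Prop where
  lt_top : ∀ x ∈ Ω, u x < ⊤
  upperSemicontinuousOn : UpperSemicontinuousOn u Ω
  le_circleMean : ∀ a b : E, (∀ ζ : ℂ, ‖ζ‖ ≤ 1 → a + ζ • b ∈ Ω) →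
    u a ≤ circleMean fun θ => u (a + Complex.exp (θ * Complex.I) • b)

/-- The pluricomplex Green function of `Ω` with logarithmic poles at the points of `S`: the
pointwise supremum of the nonpositive plurisubharmonic functions `u` on `Ω` such that, for every
`a ∈ S`, `u w ≤ log ‖w - a‖ + C` on `Ω` for some real constant `C`
(here `ENNReal.log 0 = -∞`). -/
def greenFunction {E : Type*} [NormedAddCommGroup E] [NormedSpace ℂ E]
    (Ω : Set E) (S : Finset E) (z : E) : EReal :=
  sSup {t : EReal | ∃ u : E → EReal, PlurisubharmonicOn u Ω ∧ (∀ w ∈ Ω, u w ≤ 0) ∧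
    (∀ a ∈ S, ∃ C : ℝ, ∀ w ∈ Ω, u w ≤ ENNReal.log ‖w - a‖ₑ + (C : EReal)) ∧ t = u z}

/-- Coman's Lempert function of `Ω` with poles at the points of `S`: the infimum of
`∑ a ∈ S, log |ζ a|` over all analytic disks `φ` from the unit disk to `Ω` and all points `ζ a` of
the unit disk with `φ 0 = z` and `φ (ζ a) = a` for `a ∈ S` (here `ENNReal.log 0 = -∞`). -/
def lempertFunction {E : Type*} [NormedAddCommGroup E] [NormedSpace ℂ E]
    (Ω : Set E) (S : Finset E) (z : E) : EReal :=
  sInf {t : EReal | ∃ (φ : ℂ → E) (ζ : E → ℂ),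
    DifferentiableOn ℂ φ (ball 0 1) ∧ MapsTo φ (ball 0 1) Ω ∧ φ 0 = z ∧
    (∀ a ∈ S, ζ a ∈ ball (0 : ℂ) 1 ∧ φ (ζ a) = a) ∧ t = ∑ a ∈ S, ENNReal.log ‖ζ a‖ₑ}

end

open ComplexConjugate in
/-- Schwarz lemma at an arbitrary zero of a bounded function on the unit disk. -/
theorem norm_mul_norm_one_sub_le_of_zero {f : ℂ → ℂ} {M : ℝ} {a t : ℂ}
    (hf : DifferentiableOn ℂ f (ball 0 1)) (hM : MapsTo f (ball 0 1) (closedBall 0 M))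
    (ha : a ∈ ball (0 : ℂ) 1) (hfa : f a = 0) (ht : t ∈ ball (0 : ℂ) 1) :
    ‖f t‖ * ‖1 - conj a * t‖ ≤ M * ‖t - a‖ := by
  have key : ∀ x y : ℂ, ‖x‖ < 1 → ‖y‖ < 1 → 1 + conj x * y ≠ 0 := by
    intro x y hx hy h
    have h1 : ‖conj x * y‖ = 1 := by
      rw [show conj x * y = -1 by linear_combination h]; simp
    rw [norm_mul, Complex.norm_conj] at h1
    nlinarith [norm_nonneg x, norm_nonneg y]
  have bound : ∀ x y : ℂ, ‖x‖ < 1 → ‖y‖ < 1 → ‖(y + x) / (1 + conj x * y)‖ < 1 := by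
    intro x y hx hy
    have h0 := norm_pos_iff.2 (key x y hx hy)
    rw [norm_div, div_lt_one h0]
    apply lt_of_pow_lt_pow_left₀ 2 (norm_nonneg _)
    have e : ‖1 + conj x * y‖ ^ 2 - ‖y + x‖ ^ 2 = (1 - ‖x‖ ^ 2) * (1 - ‖y‖ ^ 2) := by
      simp only [← Complex.normSq_eq_norm_sq, Complex.normSq_apply]
      simp
      ring
    have : 0 < (1 - ‖x‖ ^ 2) * (1 - ‖y‖ ^ 2) := by
      apply mul_pos <;> nlinarith [norm_nonneg x, norm_nonneg y]
    linarith
  simp only [mem_ball_zero_iff] at ha ht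
  set F : ℂ → ℂ := fun s => f ((s + a) / (1 + conj a * s)) with hF
  have hmaps : MapsTo (fun s : ℂ => (s + a) / (1 + conj a * s)) (ball 0 1) (ball 0 1) := by
    intro s hs
    simp only [mem_ball_zero_iff] at hs ⊢
    exact bound a s ha hs
  have hdF : DifferentiableOn ℂ F (ball 0 1) := by
    refine hf.comp ?_ hmaps
    intro s hs
    simp only [mem_ball_zero_iff] at hs
    have := key a s ha hs
    apply DifferentiableAt.differentiableWithinAt
    fun_prop (disch := assumption)
  have hF0 : F 0 = 0 := by simp [hF, hfa]
  have hs : (t - a) / (1 - conj a * t) ∈ ball (0 : ℂ) 1 := by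
    have := bound (-a) t (by simpa using ha) ht
    simpa [sub_eq_add_neg] using this
  have hz : 1 - conj a * t ≠ 0 := by
    have := key (-a) t (by simpa using ha) ht
    simpa [sub_eq_add_neg] using this
  have hS := Complex.dist_le_div_mul_dist_of_mapsTo_ball (R₂ := M) hdF
    (by rw [hF0]; exact hM.comp hmaps) hs
  have hFt : F ((t - a) / (1 - conj a * t)) = f t := by
    simp only [hF]
    congr 1
    have hden : 1 - conj a * a ≠ 0 := by
      have := key (-a) a (by simpa using ha) ha
      simpa [sub_eq_add_neg] using this
    have e1 : (t - a) / (1 - conj a * t) + a = t * (1 - conj a * a) / (1 - conj a * t) := by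
      rw [div_add' _ _ _ hz]
      congr 1
      ring
    have e2 : 1 + conj a * ((t - a) / (1 - conj a * t)) = (1 - conj a * a) / (1 - conj a * t) := by
      rw [eq_div_iff hz, add_mul, mul_assoc, div_mul_cancel₀ _ hz]
      ring
    rw [e1, e2, div_div_div_cancel_right₀ hz, mul_div_cancel_right₀ _ hden]
  rw [hFt, hF0, dist_zero_right, dist_zero_right, norm_div, div_one] at hS
  have hz' := norm_pos_iff.2 hz
  calc ‖f t‖ * ‖1 - conj a * t‖ ≤ M * (‖t - a‖ / ‖1 - conj a * t‖) * ‖1 - conj a * t‖ := by gcongr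
    _ = M * ‖t - a‖ := by rw [mul_assoc, div_mul_cancel₀ _ hz'.ne']

open ComplexConjugate in
/-- A bounded function on the unit disk is divisible by the Blaschke factor of each of its zeros,
without increase of the bound. -/
theorem exists_blaschke_quotient {f : ℂ → ℂ} {M : ℝ} {a : ℂ}
    (hf : DifferentiableOn ℂ f (ball 0 1)) (hM : MapsTo f (ball 0 1) (closedBall 0 M))
    (ha : a ∈ ball (0 : ℂ) 1) (hfa : f a = 0) :
    ∃ g : ℂ → ℂ, DifferentiableOn ℂ g (ball 0 1) ∧ MapsTo g (ball 0 1) (closedBall 0 M) ∧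
      ∀ t, f t * (1 - conj a * t) = (t - a) * g t := by
  have hd : DifferentiableOn ℂ (fun t => dslope f a t * (1 - conj a * t)) (ball 0 1) := by
    refine DifferentiableOn.mul ?_ (by fun_prop)
    exact (Complex.differentiableOn_dslope (isOpen_ball.mem_nhds ha)).2 hf
  have hne : ∀ t, f t * (1 - conj a * t) = (t - a) * (dslope f a t * (1 - conj a * t)) := by
    intro t
    have := sub_smul_dslope f a t
    rw [hfa, sub_zero, smul_eq_mul] at this
    rw [← mul_assoc, this]
  refine ⟨fun t => dslope f a t * (1 - conj a * t), hd, ?_, hne⟩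
  have hoff : ∀ t ∈ ball (0 : ℂ) 1, t ≠ a → ‖dslope f a t * (1 - conj a * t)‖ ≤ M := by
    intro t ht hta
    have h := norm_mul_norm_one_sub_le_of_zero hf hM ha hfa ht
    rw [← norm_mul, hne t, norm_mul, mul_comm] at h
    exact le_of_mul_le_mul_right h (norm_pos_iff.2 (sub_ne_zero.2 hta))
  intro t ht
  rw [mem_closedBall_zero_iff]
  by_cases hta : t = a
  · subst hta
    have hc : ContinuousAt (fun s => dslope f t s * (1 - conj t * s)) t :=
      (hd.differentiableAt (isOpen_ball.mem_nhds ht)).continuousAt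
    have h2 := (hc.norm.tendsto).mono_left (nhdsWithin_le_nhds (s := {t}ᶜ))
    refine le_of_tendsto h2 ?_
    filter_upwards [self_mem_nhdsWithin, mem_nhdsWithin_of_mem_nhds (isOpen_ball.mem_nhds ht)]
      with s hs hs'
    exact hoff s hs' hs
  · exact hoff t ht hta

/-- A bounded function with two zeros `x, y` and a small value at `w`, evaluated at the origin. -/
theorem two_zeros_estimate {f : ℂ → ℂ} {M : ℝ} {x y w : ℂ}
    (hf : DifferentiableOn ℂ f (ball 0 1)) (hM : MapsTo f (ball 0 1) (closedBall 0 M))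
    (hx : x ∈ ball (0 : ℂ) 1) (hy : y ∈ ball (0 : ℂ) 1) (hw : w ∈ ball (0 : ℂ) 1)
    (hxy : x ≠ y) (hfx : f x = 0) (hfy : f y = 0) :
    ‖f 0‖ ≤ M * (‖x‖ * ‖y‖) ∧
    ∀ η > 0, ‖f 0‖ ≤ η + 2 * M * (‖x‖ * ‖y‖ * ‖w‖) ∨
      ‖w - x‖ * ‖w - y‖ * η ≤ 4 * ‖f w‖ := by
  obtain ⟨g, hg, hgM, hgf⟩ := exists_blaschke_quotient hf hM hx hfx
  have hgy : g y = 0 := by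
    have := hgf y
    rw [hfy, zero_mul] at this
    rcases mul_eq_zero.1 this.symm with h | h
    · exact absurd (sub_eq_zero.1 h).symm hxy
    · exact h
  obtain ⟨h, hh, hhM, hhg⟩ := exists_blaschke_quotient hg hgM hy hgy
  have h0m : (0 : ℂ) ∈ ball (0 : ℂ) 1 := by simp
  have e0 : f 0 = x * y * h 0 := by
    have h1 := hgf 0
    have h2 := hhg 0
    simp only [mul_zero, sub_zero, mul_one, zero_sub] at h1 h2
    rw [h1, h2]; ring
  have en : ‖f 0‖ = ‖x‖ * ‖y‖ * ‖h 0‖ := by rw [e0, norm_mul, norm_mul]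
  have hM0 : 0 ≤ M := (norm_nonneg _).trans (mem_closedBall_zero_iff.1 (hM h0m))
  have b0 : ‖h 0‖ ≤ M := by simpa using hhM h0m
  have hxl : ‖x‖ < 1 := by simpa using hx
  have hyl : ‖y‖ < 1 := by simpa using hy
  have hwl : ‖w‖ < 1 := by simpa using hw
  refine ⟨?_, ?_⟩
  · rw [en, mul_comm M]; gcongr
  intro η hη
  by_contra! hcon
  obtain ⟨c1, c2⟩ := hcon
  have hS := Complex.dist_le_div_mul_dist_of_mapsTo_ball (R₂ := 2 * M) hh (by
    intro s hs
    have h1 := mem_closedBall_zero_iff.1 (hhM hs)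
    rw [mem_closedBall_iff_norm]
    calc _ ≤ ‖h s‖ + ‖h 0‖ := norm_sub_le _ _
      _ ≤ _ := by linarith) hw
  rw [dist_zero_right, div_one, dist_eq_norm] at hS
  have h3 : ‖h 0‖ ≤ ‖h w‖ + 2 * M * ‖w‖ := by
    have := norm_sub_norm_le (h 0) (h w)
    rw [norm_sub_rev] at this
    linarith
  have h4 : η < ‖h w‖ := by
    have h5 : ‖f 0‖ ≤ ‖h w‖ + 2 * M * (‖x‖ * ‖y‖ * ‖w‖) := by
      have hxy1 : ‖x‖ * ‖y‖ ≤ 1 := mul_le_one₀ hxl.le (norm_nonneg _) hyl.le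
      calc ‖f 0‖ ≤ ‖x‖ * ‖y‖ * (‖h w‖ + 2 * M * ‖w‖) := by rw [en]; gcongr
        _ = ‖x‖ * ‖y‖ * ‖h w‖ + 2 * M * (‖x‖ * ‖y‖ * ‖w‖) := by ring
        _ ≤ _ := by
          gcongr
          exact mul_le_of_le_one_left (norm_nonneg _) hxy1
    linarith
  have e1 := congrArg norm (hgf w)
  have e2 := congrArg norm (hhg w)
  rw [norm_mul, norm_mul] at e1 e2
  have bd : ∀ a : ℂ, ‖a‖ < 1 → ‖1 - (starRingEnd ℂ) a * w‖ ≤ 2 := by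
    intro a ha
    calc _ ≤ ‖(1 : ℂ)‖ + ‖(starRingEnd ℂ) a * w‖ := norm_sub_le _ _
      _ ≤ _ := by
        rw [norm_mul, Complex.norm_conj, norm_one]
        nlinarith [norm_nonneg a, norm_nonneg w]
  have : ‖w - x‖ * ‖w - y‖ * ‖h w‖ ≤ 4 * ‖f w‖ := by
    calc ‖w - x‖ * ‖w - y‖ * ‖h w‖ = ‖w - x‖ * (‖w - y‖ * ‖h w‖) := by ring
      _ = ‖f w‖ * ‖1 - (starRingEnd ℂ) x * w‖ * ‖1 - (starRingEnd ℂ) y * w‖ := by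
        rw [← e2, e1]; ring
      _ ≤ ‖f w‖ * 2 * 2 := by gcongr <;> [exact bd x hxl; exact bd y hyl]
      _ = _ := by ring
  have : ‖w - x‖ * ‖w - y‖ * η ≤ ‖w - x‖ * ‖w - y‖ * ‖h w‖ := by gcongr
  linarith

/-- Three points each of which is close to another one are close to each other, so that the product
of their norms is bounded below in terms of the two-fold products. -/
theorem pow_le_prod_norm_of_close {x y w : ℂ} {σ q : ℝ}
    (hq : 2 * σ ≤ q) (hxy : q ^ 2 ≤ ‖x‖ * ‖y‖)
    (h1 : ‖x - y‖ ≤ σ ∨ ‖x - w‖ ≤ σ) (h2 : ‖y - x‖ ≤ σ ∨ ‖y - w‖ ≤ σ)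
    (h3 : ‖w - x‖ ≤ σ ∨ ‖w - y‖ ≤ σ) :
    (q - 2 * σ) ^ 3 ≤ ‖x‖ * ‖y‖ * ‖w‖ := by
  have hσ : 0 ≤ σ := by
    rcases h1 with h | h <;> exact (norm_nonneg _).trans h
  have hd : ‖x - y‖ ≤ 2 * σ ∧ ‖x - w‖ ≤ 2 * σ ∧ ‖y - w‖ ≤ 2 * σ := by
    have a1 := norm_sub_rev x y
    have a2 := norm_sub_rev x w
    have a3 := norm_sub_rev y w
    have t1 := norm_sub_le_norm_sub_add_norm_sub x y w
    have t2 := norm_sub_le_norm_sub_add_norm_sub x w y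
    have t3 := norm_sub_le_norm_sub_add_norm_sub y x w
    refine ⟨?_, ?_, ?_⟩ <;> rcases h1 with h1 | h1 <;> rcases h2 with h2 | h2 <;>
      rcases h3 with h3 | h3 <;> linarith
  obtain ⟨d1, d2, d3⟩ := hd
  have b1 := norm_sub_norm_le x y
  have b2 := norm_sub_norm_le x w
  have b3 := norm_sub_norm_le y w
  have b4 := norm_sub_norm_le y x
  rw [norm_sub_rev] at b4
  have hx : q ≤ ‖x‖ ∨ q ≤ ‖y‖ := by
    by_contra! h
    nlinarith [norm_nonneg x, norm_nonneg y]
  have hx' : q - 2 * σ ≤ ‖x‖ := by rcases hx with h | h <;> linarith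
  have hy' : q - 2 * σ ≤ ‖y‖ := by rcases hx with h | h <;> linarith
  have hw' : q - 2 * σ ≤ ‖w‖ := by rcases hx with h | h <;> linarith
  have h0 : 0 ≤ q - 2 * σ := by linarith
  calc (q - 2 * σ) ^ 3 = (q - 2 * σ) * (q - 2 * σ) * (q - 2 * σ) := by ring
    _ ≤ _ := by gcongr

/-- Lower bound for the product of the parameters of a disk through the three points
`(0, 0)`, `(e, 0)`, `(0, e)`. -/
theorem disk_through_three_points {f g : ℂ → ℂ} {x y w e : ℂ} {η σ q : ℝ}
    (hf : DifferentiableOn ℂ f (ball 0 1)) (hg : DifferentiableOn ℂ g (ball 0 1))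
    (hfM : MapsTo f (ball 0 1) (closedBall 0 1)) (hgM : MapsTo g (ball 0 1) (closedBall 0 1))
    (hx : x ∈ ball (0 : ℂ) 1) (hy : y ∈ ball (0 : ℂ) 1) (hw : w ∈ ball (0 : ℂ) 1)
    (he : e ≠ 0) (he1 : ‖e‖ ≤ 1) (hη : 0 < η) (hσ : 0 < σ) (hes : 4 * ‖e‖ ≤ σ ^ 2 * η)
    (hfx : f x = 0) (hfy : f y = e) (hfw : f w = 0)
    (hgx : g x = 0) (hgy : g y = 0) (hgw : g w = e)
    (hq : 2 * σ ≤ q) (hq0 : q ^ 2 ≤ ‖g 0‖) :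
    ‖f 0‖ ≤ η + 2 * (‖x‖ * ‖y‖ * ‖w‖) ∨ ‖g 0‖ ≤ η + 2 * (‖x‖ * ‖y‖ * ‖w‖) ∨
      ‖f 0 + g 0 - e‖ ≤ η + 6 * (‖x‖ * ‖y‖ * ‖w‖) ∨
      (q - 2 * σ) ^ 3 ≤ ‖x‖ * ‖y‖ * ‖w‖ := by
  have hxy : x ≠ y := by rintro rfl; exact he (by rw [← hfy, hfx])
  have hxw : x ≠ w := by rintro rfl; exact he (by rw [← hgw, hgx])
  have hyw : y ≠ w := by rintro rfl; exact he (by rw [← hgw, hgy])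
  have close : ∀ u v c : ℝ, 0 ≤ u → 0 ≤ v → u * v * η ≤ 4 * c → c = ‖e‖ → u ≤ σ ∨ v ≤ σ := by
    rintro u v c hu hv huv rfl
    by_contra! h
    have h1 : σ ^ 2 < u * v := by nlinarith
    nlinarith
  obtain ⟨F1, F2⟩ := two_zeros_estimate hf hfM hx hw hy hxw hfx hfw
  obtain ⟨G1, G2⟩ := two_zeros_estimate hg hgM hx hy hw hxy hgx hgy
  have hkM : MapsTo (fun t => f t + g t - e) (ball 0 1) (closedBall 0 3) := by
    intro t ht
    have h1 := mem_closedBall_zero_iff.1 (hfM ht)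
    have h2 := mem_closedBall_zero_iff.1 (hgM ht)
    rw [mem_closedBall_zero_iff]
    calc _ ≤ ‖f t + g t‖ + ‖e‖ := norm_sub_le _ _
      _ ≤ ‖f t‖ + ‖g t‖ + ‖e‖ := by gcongr; exact norm_add_le _ _
      _ ≤ 3 := by linarith
  obtain ⟨K1, K2⟩ := two_zeros_estimate (f := fun t => f t + g t - e) (by fun_prop) hkM hy hw hx
    hyw (by simp [hfy, hgy]) (by simp [hfw, hgw])
  rcases F2 η hη with h | cF
  · left; convert h using 1; ring
  rcases G2 η hη with h | cG
  · right; left; convert h using 1; ring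
  rcases K2 η hη with h | cK
  · right; right; left; convert h using 1; ring
  right; right; right
  refine pow_le_prod_norm_of_close hq (hq0.trans (by simpa using G1)) ?_ ?_ ?_
  · exact close _ _ _ (norm_nonneg _) (norm_nonneg _) cK (by simp [hfx, hgx])
  · exact close _ _ _ (norm_nonneg _) (norm_nonneg _) cF (by rw [hfy])
  · exact close _ _ _ (norm_nonneg _) (norm_nonneg _) cG (by rw [hgw])

theorem circleMean_mono {f g : ℝ → EReal} (h : ∀ θ, f θ ≤ g θ) : circleMean f ≤ circleMean g := by
  unfold circleMean
  refine EReal.sub_le_sub ?_ ?_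
  · refine EReal.coe_ennreal_le_coe_ennreal_iff.2 (ENNReal.div_le_div_right (lintegral_mono ?_) _)
    exact fun θ => EReal.toENNReal_le_toENNReal (h θ)
  · refine EReal.coe_ennreal_le_coe_ennreal_iff.2 (ENNReal.div_le_div_right (lintegral_mono ?_) _)
    exact fun θ => EReal.toENNReal_le_toENNReal (EReal.neg_le_neg_iff.2 (h θ))

theorem circleMean_coe {Q : ℝ → ℝ} (hQ : IntegrableOn Q (Ioc 0 (2 * Real.pi))) :
    circleMean (fun θ => (Q θ : EReal)) =
      (((2 * Real.pi)⁻¹ * ∫ θ in (0 : ℝ)..(2 * Real.pi), Q θ : ℝ) : EReal) := by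
  have hpi : 0 < 2 * Real.pi := by positivity
  rw [intervalIntegral.integral_of_le hpi.le,
    integral_eq_lintegral_pos_part_sub_lintegral_neg_part hQ]
  have hp : ∫⁻ θ in Ioc 0 (2 * Real.pi), ENNReal.ofReal (Q θ) ≠ ⊤ :=
    hQ.lintegral_lt_top.ne
  have hn : ∫⁻ θ in Ioc 0 (2 * Real.pi), ENNReal.ofReal (-Q θ) ≠ ⊤ :=
    hQ.neg.lintegral_lt_top.ne
  have aux : ∀ x : ENNReal, x ≠ ⊤ →
      ((x / ENNReal.ofReal (2 * Real.pi) : ENNReal) : EReal) =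
        (((2 * Real.pi)⁻¹ * x.toReal : ℝ) : EReal) := by
    intro x hx
    have : x / ENNReal.ofReal (2 * Real.pi) ≠ ⊤ :=
      ENNReal.div_ne_top hx (by simpa using Real.pi_pos)
    rw [← EReal.coe_toReal (x := ((x / ENNReal.ofReal (2 * Real.pi) : ENNReal) : EReal))
      (by simpa using this) (by simp), EReal.toReal_coe_ennreal, ENNReal.toReal_div,
      ENNReal.toReal_ofReal hpi.le, div_eq_inv_mul]
  unfold circleMean
  simp only [← EReal.coe_neg, EReal.real_coe_toENNReal]
  rw [aux _ hp, aux _ hn, ← EReal.coe_sub, mul_sub]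

/-- The sub-mean value inequality against a real majorant on a circle. -/
theorem PlurisubharmonicOn.le_circleAverage {E : Type*} [NormedAddCommGroup E] [NormedSpace ℂ E]
    {u : E → EReal} {Ω : Set E} (hu : PlurisubharmonicOn u Ω) {x b : E} {r : ℝ} (hr : 0 ≤ r)
    (hΩ : ∀ τ : ℂ, ‖τ‖ ≤ r → x + τ • b ∈ Ω) {q : ℂ → ℝ} (hq : ContinuousOn q (sphere 0 r))
    (hle : ∀ τ ∈ sphere (0 : ℂ) r, u (x + τ • b) ≤ q τ) :
    u x ≤ (Real.circleAverage q 0 r : ℝ) := by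
  have h1 := hu.le_circleMean x ((r : ℂ) • b) (by
    intro ζ hζ
    rw [smul_smul]
    apply hΩ
    rw [norm_mul, Complex.norm_real, Real.norm_of_nonneg hr]
    exact mul_le_of_le_one_left hr hζ)
  refine h1.trans ?_
  have hint : CircleIntegrable q 0 r := hq.circleIntegrable hr
  have h2 := circleMean_coe (Q := fun θ => q (circleMap 0 r θ))
    ((intervalIntegrable_iff_integrableOn_Ioc_of_le (by positivity)).1 hint)
  rw [Real.circleAverage_def, smul_eq_mul, ← h2]
  refine circleMean_mono fun θ => ?_
  have h3 : Complex.exp (θ * Complex.I) • (r : ℂ) • b = circleMap 0 r θ • b := by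
    rw [smul_smul, circleMap_zero, mul_comm]
  rw [h3]
  exact hle _ (circleMap_mem_sphere 0 hr θ)

theorem circleAverage_re_of_differentiable {H : ℂ → ℂ} (hH : Differentiable ℂ H) (r : ℝ) :
    Real.circleAverage (fun τ => (H τ).re) 0 r = (H 0).re := by
  have h := Complex.reCLM.circleAverage_comp_comm (f := H) (c := 0) (R := r)
    (hH.continuous.continuousOn.circleIntegrable')
  rw [hH.diffContOnCl.circleAverage] at h
  exact h

open Filter Topology in
/-- A plurisubharmonic function cannot be touched from above, at a point `(t₁, v₁)`, in the
coordinates `(t, v) ↦ φ t + v`, by the logarithm of the modulus of a holomorphic function of `t`,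
minus `δ ‖t‖ ^ 2`, plus a multiple of `‖v‖ ^ 2`. -/
theorem PlurisubharmonicOn.not_touched {E : Type*} [NormedAddCommGroup E] [InnerProductSpace ℂ E]
    [CompleteSpace E]
    {u : E → EReal} {Ω : Set E} (hu : PlurisubharmonicOn u Ω) {φ : ℂ → E} {P : ℂ → ℂ}
    (hφ : Differentiable ℂ φ) (hP : Differentiable ℂ P) {t₁ : ℂ} {v₁ : E} (hP1 : P t₁ ≠ 0)
    {u₁ κ δ K : ℝ} (hδ : 0 < δ) (hK : 0 ≤ K) (hu1 : u (φ t₁ + v₁) = u₁)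
    (h : ∀ᶠ p : ℂ × E in 𝓝 (t₁, v₁), φ p.1 + p.2 ∈ Ω ∧ u (φ p.1 + p.2) ≤
      ((u₁ + κ * (Real.log ‖P p.1‖ - Real.log ‖P t₁‖) - δ * (‖p.1‖ ^ 2 - ‖t₁‖ ^ 2)
        + K * (‖p.2‖ ^ 2 - ‖v₁‖ ^ 2) : ℝ) : EReal)) : False := by
  set b : E := deriv φ t₁ with hb
  set e : ℂ → E := fun τ => φ t₁ + τ • b - φ (t₁ + τ) with he
  have hed : Differentiable ℂ e := by
    have : Differentiable ℂ fun τ : ℂ => φ (t₁ + τ) :=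
      hφ.comp (differentiable_id.const_add t₁)
    simp only [he]
    fun_prop
  have he0 : e 0 = 0 := by simp [he]
  have hO : ∃ C : ℝ, ∀ᶠ τ in 𝓝 (0 : ℂ), ‖e τ‖ ≤ C * ‖τ‖ ^ 2 := by
    have hD : DifferentiableAt ℂ (dslope φ t₁) t₁ :=
      ((Complex.differentiableOn_dslope (univ_mem)).2 hφ.differentiableOn).differentiableAt
        univ_mem
    obtain ⟨C, hC⟩ := hD.isBigO_sub.bound
    refine ⟨C, ?_⟩
    have ht : Tendsto (fun τ : ℂ => t₁ + τ) (𝓝 0) (𝓝 t₁) := by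
      have : Continuous fun τ : ℂ => t₁ + τ := by fun_prop
      simpa using this.tendsto 0
    filter_upwards [ht.eventually hC] with τ hτ
    have e1 := sub_smul_dslope φ t₁ (t₁ + τ)
    rw [add_sub_cancel_left] at e1 hτ
    rw [dslope_same] at hτ
    have : e τ = -(τ • (dslope φ t₁ (t₁ + τ) - b)) := by
      rw [smul_sub, e1]; simp only [he]; abel
    rw [this, norm_neg, norm_smul, pow_two]
    calc _ ≤ ‖τ‖ * (C * ‖τ‖) := by gcongr
      _ = _ := by ring
  obtain ⟨C, hC⟩ := hO
  have hpath : Tendsto (fun τ : ℂ => (t₁ + τ, v₁ + e τ)) (𝓝 0) (𝓝 (t₁, v₁)) := by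
    have : Continuous fun τ : ℂ => (t₁ + τ, v₁ + e τ) := by
      have := hed.continuous
      fun_prop
    simpa [he0] using this.tendsto 0
  have hPne : ∀ᶠ τ in 𝓝 (0 : ℂ), P (t₁ + τ) ≠ 0 := by
    have hc : Continuous fun τ : ℂ => P (t₁ + τ) := hP.continuous.comp (by fun_prop)
    exact hc.continuousAt.eventually_ne (by simpa using hP1)
  obtain ⟨ρ, hρ, hball⟩ := Metric.nhds_basis_closedBall.eventually_iff.1
    (hC.and ((hpath.eventually h).and hPne))
  -- a radius so small that the quartic error is negligible
  obtain ⟨r, hr, hrρ, hrK⟩ : ∃ r : ℝ, 0 < r ∧ r ≤ ρ ∧ K * C ^ 2 * r ^ 2 < δ := by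
    have hc : Tendsto (fun r : ℝ => K * C ^ 2 * r ^ 2) (𝓝[>] 0) (𝓝 0) := by
      have : Continuous fun r : ℝ => K * C ^ 2 * r ^ 2 := by fun_prop
      have h0 : Tendsto (fun r : ℝ => K * C ^ 2 * r ^ 2) (𝓝 0) (𝓝 0) := by
        simpa using this.tendsto 0
      exact h0.mono_left nhdsWithin_le_nhds
    obtain ⟨r, h1, h2⟩ := ((hc.eventually (gt_mem_nhds hδ)).and
      (Ioc_mem_nhdsGT hρ)).exists
    exact ⟨r, h2.1, h2.2, h1⟩
  have hmem : ∀ τ : ℂ, ‖τ‖ ≤ r → τ ∈ closedBall (0 : ℂ) ρ := fun τ hτ => by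
    rw [mem_closedBall_zero_iff]; exact hτ.trans hrρ
  have hx : ∀ τ : ℂ, φ t₁ + v₁ + τ • b = φ (t₁ + τ) + (v₁ + e τ) := by
    intro τ; simp only [he]; abel
  set H : ℂ → ℂ := fun τ => (-(2 * δ) : ℂ) * (starRingEnd ℂ t₁ * τ)
    + (2 * K : ℂ) * inner ℂ v₁ (e τ) with hH
  have hHd : Differentiable ℂ H := by
    have : Differentiable ℂ fun τ => inner ℂ v₁ (e τ) := (innerSL ℂ v₁).differentiable.comp hed
    simp only [hH]
    fun_prop
  have hlogc : ContinuousOn (fun τ => Real.log ‖P (t₁ + τ)‖) (sphere 0 r) := by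
    have hc : Continuous fun τ : ℂ => P (t₁ + τ) := hP.continuous.comp (by fun_prop)
    refine hc.norm.continuousOn.log fun τ hτ => norm_ne_zero_iff.2 ?_
    exact (hball (hmem τ (mem_sphere_zero_iff_norm.1 hτ).le)).2.2
  have hHc : ContinuousOn (fun τ => (H τ).re) (sphere 0 r) :=
    (Complex.continuous_re.comp hHd.continuous).continuousOn
  set A : ℝ := u₁ - κ * Real.log ‖P t₁‖ - δ * r ^ 2 + K * (C ^ 2 * r ^ 4) with hA
  have hmaj := hu.le_circleAverage (x := φ t₁ + v₁) (b := b) hr.le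
    (fun τ hτ => by rw [hx]; exact (hball (hmem τ hτ)).2.1.1)
    (q := fun τ => (A + κ * Real.log ‖P (t₁ + τ)‖) + (H τ).re)
    (by fun_prop) (by
      intro τ hτ
      have hτ' := mem_sphere_zero_iff_norm.1 hτ
      obtain ⟨b1, b2, -⟩ := hball (hmem τ hτ'.le)
      rw [hx]
      refine b2.2.trans (EReal.coe_le_coe_iff.2 ?_)
      have n1 : ‖t₁ + τ‖ ^ 2 = ‖t₁‖ ^ 2 + 2 * (starRingEnd ℂ t₁ * τ).re + r ^ 2 := by
        rw [← hτ']
        simp only [← Complex.normSq_eq_norm_sq, Complex.normSq_apply]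
        simp
        ring
      have n2 : ‖v₁ + e τ‖ ^ 2 = ‖v₁‖ ^ 2 + 2 * (inner ℂ v₁ (e τ)).re + ‖e τ‖ ^ 2 :=
        norm_add_sq (𝕜 := ℂ) v₁ (e τ)
      have n3 : ‖e τ‖ ^ 2 ≤ C ^ 2 * r ^ 4 := by
        rw [hτ'] at b1
        calc ‖e τ‖ ^ 2 ≤ (C * r ^ 2) ^ 2 := by gcongr
          _ = _ := by ring
      have n4 : (H τ).re = -(2 * δ) * (starRingEnd ℂ t₁ * τ).re
          + 2 * K * (inner ℂ v₁ (e τ)).re := by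
        have h1 : ((-(2 * δ) : ℂ)) = ((-(2 * δ) : ℝ) : ℂ) := by push_cast; ring
        have h2 : ((2 * K : ℂ)) = ((2 * K : ℝ) : ℂ) := by push_cast; ring
        simp only [hH]
        rw [h1, h2, Complex.add_re, Complex.re_ofReal_mul, Complex.re_ofReal_mul]
      have n5 : K * ‖e τ‖ ^ 2 ≤ K * (C ^ 2 * r ^ 4) := by gcongr
      simp only
      rw [n1, n2, n4, hA]
      linarith)
  have avg : Real.circleAverage (fun τ => (A + κ * Real.log ‖P (t₁ + τ)‖) + (H τ).re) 0 r
      = A + κ * Real.log ‖P t₁‖ := by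
    have c1 : CircleIntegrable (fun τ => Real.log ‖P (t₁ + τ)‖) 0 r := hlogc.circleIntegrable hr.le
    have c2 : CircleIntegrable (fun τ => κ * Real.log ‖P (t₁ + τ)‖) 0 r :=
      (continuousOn_const.mul hlogc).circleIntegrable hr.le
    have c3 : CircleIntegrable (fun τ => A + κ * Real.log ‖P (t₁ + τ)‖) 0 r :=
      (continuousOn_const.add (continuousOn_const.mul hlogc)).circleIntegrable hr.le
    rw [Real.circleAverage_fun_add c3 (hHc.circleIntegrable hr.le),
      Real.circleAverage_fun_add (circleIntegrable_const _ _ _) c2, Real.circleAverage_const,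
      circleAverage_re_of_differentiable hHd]
    have := Real.circleAverage_fun_smul (a := κ) (f := fun τ => Real.log ‖P (t₁ + τ)‖)
      (c := 0) (R := r)
    simp only [smul_eq_mul] at this
    rw [this]
    have hjen := AnalyticOnNhd.circleAverage_log_norm_of_ne_zero (R := r) (c := 0)
      (g := fun τ => P (t₁ + τ))
      (fun τ _ => (hP.comp (differentiable_id.const_add t₁)).analyticAt τ) (by
        intro τ hτ
        rw [abs_of_pos hr, mem_closedBall_zero_iff] at hτ
        exact (hball (hmem τ hτ)).2.2)
    rw [hjen]
    simp [hH, he0]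
  rw [avg, hu1, EReal.coe_le_coe_iff, hA] at hmaj
  have hr2 : 0 < r ^ 2 := by positivity
  nlinarith

open Filter Topology in
/-- If, along an entire curve, a nonpositive plurisubharmonic function has at least the logarithmic
poles given by the zeros of a holomorphic function `P`, it is bounded along the curve by the
logarithm of `P` normalised by its smallest modulus on the boundary. -/
theorem PlurisubharmonicOn.le_log_norm_div {E : Type*} [NormedAddCommGroup E]
    [InnerProductSpace ℂ E] [FiniteDimensional ℂ E]
    {u : E → EReal} {Ω : Set E} (hu : PlurisubharmonicOn u Ω) (hΩ : IsOpen Ω)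
    (hu0 : ∀ x ∈ Ω, u x ≤ 0) {φ : ℂ → E} {P : ℂ → ℂ} (hφ : Differentiable ℂ φ)
    (hP : Differentiable ℂ P) {R m C : ℝ} (hm : 0 < m)
    (hφΩ : MapsTo φ (closedBall 0 R) Ω) (hPm : ∀ t ∈ sphere (0 : ℂ) R, m ≤ ‖P t‖)
    (hpole : ∀ t ∈ closedBall (0 : ℂ) R, P t ≠ 0 → u (φ t) ≤ (Real.log ‖P t‖ + C : ℝ))
    {t₀ : ℂ} (ht₀ : t₀ ∈ closedBall (0 : ℂ) R) (hP0 : P t₀ ≠ 0) :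
    u (φ t₀) ≤ (Real.log (‖P t₀‖ / m) : ℝ) := by
  have : ProperSpace E := FiniteDimensional.proper ℂ E
  have : CompleteSpace E := FiniteDimensional.complete ℂ E
  rw [Real.log_div (norm_ne_zero_iff.2 hP0) hm.ne']
  by_contra! hcon
  obtain ⟨c, hc1, hc2⟩ := EReal.lt_iff_exists_real_btwn.1 hcon
  rw [EReal.coe_lt_coe_iff] at hc1
  set L := Real.log ‖P t₀‖ - Real.log m with hL
  obtain ⟨η, hη0, hη1, hηL⟩ : ∃ η : ℝ, 0 < η ∧ η < 1 ∧ (1 - η) * L < (c + L) / 2 := by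
    have hcont : Tendsto (fun η : ℝ => (1 - η) * L) (𝓝[>] 0) (𝓝 L) := by
      have : Continuous fun η : ℝ => (1 - η) * L := by fun_prop
      have h0 : Tendsto (fun η : ℝ => (1 - η) * L) (𝓝 0) (𝓝 L) := by simpa using this.tendsto 0
      exact h0.mono_left nhdsWithin_le_nhds
    obtain ⟨η, h1, h2⟩ := ((hcont.eventually (gt_mem_nhds (show L < (c + L) / 2 by linarith))).and
      (Ioo_mem_nhdsGT one_pos)).exists
    exact ⟨η, h2.1, h2.2, h1⟩
  obtain ⟨δ, hδ, hδR⟩ : ∃ δ : ℝ, 0 < δ ∧ δ * R ^ 2 < (c - L) / 2 := by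
    refine ⟨(c - L) / 2 / (R ^ 2 + 1), by have : 0 < c - L := sub_pos.2 hc1
                                          positivity, ?_⟩
    rw [div_mul_eq_mul_div, div_lt_iff₀ (by positivity)]
    have : 0 < c - L := sub_pos.2 hc1
    nlinarith
  -- the comparison function
  set l : ℂ → ℝ := fun t => (1 - η) * (Real.log ‖P t‖ - Real.log m) - δ * ‖t‖ ^ 2 + δ * R ^ 2
    with hl
  set μ : ℝ := c - l t₀ with hμ
  have hμ0 : 0 < μ := by
    have : 0 ≤ δ * ‖t₀‖ ^ 2 := by positivity
    simp only [hμ, hl]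
    rw [← hL]
    linarith
  set lam : ℝ := min (-(|C| + |Real.log m|) / η) (Real.log ‖P t₀‖) with hlam
  set s : ℝ := Real.exp lam with hs
  have hs0 : 0 < s := Real.exp_pos _
  set A : Set ℂ := {t ∈ closedBall 0 R | s ≤ ‖P t‖} with hA
  set B : Set ℂ := {t ∈ A | ‖t‖ = R ∨ ‖P t‖ = s} with hB
  have hPc := hP.continuous
  have hAc : IsCompact A :=
    (isCompact_closedBall 0 R).inter_right (isClosed_le continuous_const hPc.norm)
  have hBc : IsCompact B :=
    hAc.inter_right ((isClosed_eq continuous_norm continuous_const).union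
      (isClosed_eq hPc.norm continuous_const))
  have hAP : ∀ t ∈ A, P t ≠ 0 := fun t ht => norm_pos_iff.1 (hs0.trans_le ht.2)
  have hlc : ∀ t, P t ≠ 0 → ContinuousAt l t := by
    intro t ht
    have h1 : ContinuousAt (fun t => Real.log ‖P t‖) t :=
      hPc.norm.continuousAt.log (norm_ne_zero_iff.2 ht)
    simp only [hl]
    fun_prop
  have ht₀A : t₀ ∈ A := by
    refine ⟨ht₀, ?_⟩
    rw [hs, ← Real.le_log_iff_exp_le (norm_pos_iff.2 hP0)]
    exact min_le_right _ _
  have hboundary : ∀ t ∈ B, u (φ t) < ((μ + l t : ℝ) : EReal) := by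
    rintro t ⟨htA, ht | ht⟩
    · refine (hu0 _ (hφΩ htA.1)).trans_lt ?_
      rw [← EReal.coe_zero, EReal.coe_lt_coe_iff]
      have h1 : Real.log m ≤ Real.log ‖P t‖ :=
        Real.log_le_log hm (hPm t (mem_sphere_zero_iff_norm.2 ht))
      have h2 : 0 ≤ (1 - η) * (Real.log ‖P t‖ - Real.log m) :=
        mul_nonneg (by linarith) (by linarith)
      simp only [hl]
      rw [ht]
      linarith
    · refine (hpole t htA.1 (hAP t htA)).trans_lt ?_
      rw [EReal.coe_lt_coe_iff]
      have h0 : Real.log ‖P t‖ = lam := by rw [ht, hs, Real.log_exp]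
      have h1 : η * lam ≤ -(|C| + |Real.log m|) := by
        have : lam ≤ -(|C| + |Real.log m|) / η := min_le_left _ _
        rw [le_div_iff₀ hη0] at this
        linarith
      have h2 : (1 - η) * Real.log m ≤ |Real.log m| := by
        calc (1 - η) * Real.log m ≤ (1 - η) * |Real.log m| :=
              mul_le_mul_of_nonneg_left (le_abs_self _) (by linarith)
          _ ≤ _ := mul_le_of_le_one_left (abs_nonneg _) (by linarith)
      have h3 : δ * ‖t‖ ^ 2 ≤ δ * R ^ 2 := by
        have := mem_closedBall_zero_iff.1 htA.1
        gcongr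
      have h4 := le_abs_self C
      simp only [hl]
      rw [h0]
      linarith
  have hnear : ∀ᶠ v in 𝓝 (0 : E), ∀ t ∈ B, u (φ t + v) < ((μ + l t : ℝ) : EReal) := by
    refine hBc.eventually_forall_of_forall_eventually fun t ht => ?_
    obtain ⟨ν, hν1, hν2⟩ := EReal.lt_iff_exists_real_btwn.1 (hboundary t ht)
    have hmem : φ t ∈ Ω := hφΩ ht.1.1
    have h1 : ∀ᶠ x in 𝓝 (φ t), u x < ν := by
      have := hu.upperSemicontinuousOn (φ t) hmem ν hν1
      rwa [hΩ.nhdsWithin_eq hmem] at this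
    have h2 : ∀ᶠ t' in 𝓝 t, ν < μ + l t' :=
      ((hlc t (hAP t ht.1)).const_add μ).eventually
        (lt_mem_nhds (by simpa only [EReal.coe_lt_coe_iff] using hν2))
    have c1 : Tendsto (fun z : E × ℂ => φ z.2 + z.1) (𝓝 (0, t)) (𝓝 (φ t)) := by
      have : Continuous fun z : E × ℂ => φ z.2 + z.1 := by
        have := hφ.continuous
        fun_prop
      simpa using this.tendsto (0, t)
    have c2 : Tendsto (fun z : E × ℂ => z.2) (𝓝 (0, t)) (𝓝 t) := continuous_snd.tendsto (0, t)
    filter_upwards [c1.eventually h1, c2.eventually h2] with z hz1 hz2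
    exact hz1.trans (EReal.coe_lt_coe_iff.2 hz2)
  have hin : ∀ᶠ v in 𝓝 (0 : E), ∀ t ∈ closedBall (0 : ℂ) R, φ t + v ∈ Ω := by
    refine (isCompact_closedBall 0 R).eventually_forall_of_forall_eventually fun t ht => ?_
    have : Continuous fun z : E × ℂ => φ z.2 + z.1 := by
      have := hφ.continuous
      fun_prop
    exact this.continuousAt.eventually_mem (hΩ.mem_nhds (by simpa using hφΩ ht))
  obtain ⟨d, hd, hdball⟩ := Metric.nhds_basis_closedBall.eventually_iff.1 (hnear.and hin)
  obtain ⟨M, hM⟩ : ∃ M, ∀ t ∈ A, -l t ≤ M := by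
    have : ContinuousOn (fun t => -l t) A := fun t ht => (hlc t (hAP t ht)).neg.continuousWithinAt
    obtain ⟨M, hM⟩ := hAc.bddAbove_image this
    exact ⟨M, fun t ht => hM (mem_image_of_mem _ ht)⟩
  set K : ℝ := |M| / d ^ 2 with hK
  have hK0 : 0 ≤ K := by positivity
  set w : ℂ × E → ℝ := fun p => -l p.1 - K * ‖p.2‖ ^ 2 with hw
  set F : ℂ × E → EReal := fun p => u (φ p.1 + p.2) + (w p : EReal) with hF
  have hFusc : UpperSemicontinuousOn F (A ×ˢ closedBall 0 d) := by
    refine UpperSemicontinuousOn.add' ?_ ?_ ?_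
    · have hc : ContinuousOn (fun p : ℂ × E => φ p.1 + p.2) (A ×ˢ closedBall 0 d) := by
        have := hφ.continuous
        fun_prop
      exact hu.upperSemicontinuousOn.comp hc fun p hp => (hdball hp.2).2 p.1 hp.1.1
    · refine ContinuousOn.upperSemicontinuousOn (continuous_coe_real_ereal.comp_continuousOn ?_)
      have h1 : ContinuousOn (fun p : ℂ × E => l p.1) (A ×ˢ closedBall 0 d) := fun p hp =>
        ((hlc p.1 (hAP _ hp.1)).comp continuousAt_fst).continuousWithinAt
      exact h1.neg.sub (continuousOn_const.mul (continuousOn_snd.norm.pow 2))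
    · exact fun p _ => EReal.continuousAt_add (Or.inr (EReal.coe_ne_bot _))
        (Or.inr (EReal.coe_ne_top _))
  have h0mem : ((t₀, 0) : ℂ × E) ∈ A ×ˢ closedBall (0 : E) d := ⟨ht₀A, by simpa using hd.le⟩
  obtain ⟨⟨t₁, v₁⟩, ⟨ht₁, hv₁⟩, hmax⟩ := hFusc.exists_isMaxOn ⟨_, h0mem⟩
    (hAc.prod (isCompact_closedBall 0 d))
  simp only at ht₁ hv₁
  have hmemΩ : ∀ t ∈ A, ∀ v ∈ closedBall (0 : E) d, φ t + v ∈ Ω := fun t ht v hv =>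
    (hdball hv).2 t ht.1
  have hFμ : (μ : EReal) < F (t₁, v₁) := by
    refine lt_of_lt_of_le ?_ (hmax h0mem)
    have e1 : (μ : EReal) = (c : EReal) + (w (t₀, 0) : EReal) := by
      rw [← EReal.coe_add, EReal.coe_eq_coe_iff]
      simp [hw, hμ]
      ring
    rw [e1]
    simp only [hF, add_zero]
    exact EReal.add_lt_add_right_coe hc2 _
  obtain ⟨u₁, hu₁⟩ : ∃ u₁ : ℝ, u (φ t₁ + v₁) = u₁ := by
    have htop := hu.lt_top _ (hmemΩ t₁ ht₁ v₁ hv₁)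
    have hbot : u (φ t₁ + v₁) ≠ ⊥ := by
      intro hb
      simp [hF, hb] at hFμ
    exact ⟨_, (EReal.coe_toReal htop.ne hbot).symm⟩
  have hF1 : F (t₁, v₁) = ((u₁ + w (t₁, v₁) : ℝ) : EReal) := by
    simp only [hF, hu₁, EReal.coe_add]
  have hbound : ∀ t ∈ A, ∀ v ∈ closedBall (0 : E) d,
      u (φ t + v) ≤ ((u₁ + w (t₁, v₁) - w (t, v) : ℝ) : EReal) := by
    intro t ht v hv
    have h1 : F (t, v) ≤ F (t₁, v₁) := hmax (show (t, v) ∈ A ×ˢ closedBall (0 : E) d from ⟨ht, hv⟩)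
    rw [hF1] at h1
    rw [EReal.coe_sub]
    exact EReal.le_sub_iff_add_le (Or.inl (EReal.coe_ne_bot _)) (Or.inl (EReal.coe_ne_top _)) |>.2 h1
  rw [hF1, EReal.coe_lt_coe_iff] at hFμ
  have hKv : 0 ≤ K * ‖v₁‖ ^ 2 := by positivity
  have hnotB : t₁ ∉ B := by
    intro hb
    have h1 := (hdball hv₁).1 t₁ hb
    rw [hu₁, EReal.coe_lt_coe_iff] at h1
    simp only [hw] at hFμ
    linarith
  have hv₁d : ‖v₁‖ < d := by
    refine lt_of_le_of_ne (mem_closedBall_zero_iff.1 hv₁) fun hv => ?_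
    have h1 := hu0 _ (hmemΩ t₁ ht₁ v₁ hv₁)
    rw [hu₁, ← EReal.coe_zero, EReal.coe_le_coe_iff] at h1
    have h2 : K * ‖v₁‖ ^ 2 = |M| := by
      rw [hv, hK]; field_simp
    have h3 := hM t₁ ht₁
    have h4 := le_abs_self M
    simp only [hw] at hFμ
    linarith
  have ht₁R : ‖t₁‖ < R := lt_of_le_of_ne (mem_closedBall_zero_iff.1 ht₁.1)
    fun h => hnotB ⟨ht₁, Or.inl h⟩
  have ht₁s : s < ‖P t₁‖ := lt_of_le_of_ne ht₁.2 fun h => hnotB ⟨ht₁, Or.inr h.symm⟩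
  refine hu.not_touched hφ hP (hAP t₁ ht₁) (κ := 1 - η) hδ hK0 hu₁ ?_
  have e1 : ∀ᶠ p : ℂ × E in 𝓝 (t₁, v₁), ‖p.1‖ < R :=
    (continuous_fst.norm.tendsto (t₁, v₁)).eventually (gt_mem_nhds ht₁R)
  have e2 : ∀ᶠ p : ℂ × E in 𝓝 (t₁, v₁), s < ‖P p.1‖ :=
    ((hPc.comp continuous_fst).norm.tendsto (t₁, v₁)).eventually (lt_mem_nhds ht₁s)
  have e3 : ∀ᶠ p : ℂ × E in 𝓝 (t₁, v₁), ‖p.2‖ < d :=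
    (continuous_snd.norm.tendsto (t₁, v₁)).eventually (gt_mem_nhds hv₁d)
  filter_upwards [e1, e2, e3] with p h1 h2 h3
  have hpA : p.1 ∈ A := ⟨mem_closedBall_zero_iff.2 h1.le, h2.le⟩
  have hpd : p.2 ∈ closedBall (0 : E) d := mem_closedBall_zero_iff.2 h3.le
  refine ⟨hmemΩ _ hpA _ hpd, (hbound _ hpA _ hpd).trans_eq ?_⟩
  rw [EReal.coe_eq_coe_iff]
  simp only [hw, hl]
  ring

noncomputable section

theorem ENNReal.log_enorm_le {E : Type*} [SeminormedAddGroup E] {x : E} {r : ℝ} (hr : 0 < r)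
    (hx : ‖x‖ ≤ r) : ENNReal.log ‖x‖ₑ ≤ (Real.log r : ℝ) := by
  rw [← ENNReal.log_ofReal_of_pos hr, ← ofReal_norm]
  exact ENNReal.log_monotone (ENNReal.ofReal_le_ofReal hx)

theorem ENNReal.le_log_enorm {E : Type*} [SeminormedAddGroup E] {x : E} {r : ℝ} (hr : 0 < r)
    (hx : r ≤ ‖x‖) : (Real.log r : ℝ) ≤ ENNReal.log ‖x‖ₑ := by
  rw [← ENNReal.log_ofReal_of_pos hr, ← ofReal_norm]
  exact ENNReal.log_monotone (ENNReal.ofReal_le_ofReal hx)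

theorem EuclideanSpace.norm_pair_sq (x y : ℂ) :
    ‖(!₂[x, y] : EuclideanSpace ℂ (Fin 2))‖ ^ 2 = ‖x‖ ^ 2 + ‖y‖ ^ 2 := by
  simp [EuclideanSpace.norm_sq_eq, Fin.sum_univ_two]

theorem EuclideanSpace.norm_pair_le (x y : ℂ) :
    ‖(!₂[x, y] : EuclideanSpace ℂ (Fin 2))‖ ≤ ‖x‖ + ‖y‖ := by
  apply le_of_sq_le_sq _ (by positivity)
  rw [norm_pair_sq]
  nlinarith [norm_nonneg x, norm_nonneg y]

/-- The distance parameter of the configuration. -/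
def nodalParam : ℂ := 1 / 10 ^ 14

/-- The quadratic polynomial with zeros at the two parameters of the node `(0, 0)`. -/
def nodeA (t : ℂ) : ℂ := t ^ 2 - 1 + nodalParam

/-- The quadratic polynomial with zeros at the two parameters of the node on the first axis. -/
def nodeB (t : ℂ) : ℂ := t ^ 2 + t + nodalParam

/-- The quadratic polynomial with zeros at the two parameters of the node on the second axis. -/
def nodeC (t : ℂ) : ℂ := t ^ 2 - t + nodalParam

/-- A rational quartic curve with three nodes close to the origin. -/
def nodalQuartic (t : ℂ) : EuclideanSpace ℂ (Fin 2) :=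
  !₂[1 / 16000 * (nodeA t * nodeC t), 1 / 16000 * (nodeA t * nodeB t)]

/-- The nonzero coordinate of the two nodes different from the origin. -/
def nodeCoord : ℂ := -(1 / 8000 * nodalParam)

theorem norm_nodalParam_le : ‖nodalParam‖ ≤ 1 / 100 := by norm_num [nodalParam]

theorem norm_nodalParam_sub_one_le : ‖nodalParam - 1‖ ≤ 1 := by
  rw [show nodalParam - 1 = ((1 / 10 ^ 14 - 1 : ℝ) : ℂ) by simp [nodalParam], Complex.norm_real]
  norm_num [abs_of_neg]

theorem norm_nodeA_le {t : ℂ} (ht : ‖t‖ ≤ 10) : ‖nodeA t‖ ≤ 101 := by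
  have h : nodeA t = t ^ 2 + (nodalParam - 1) := by unfold nodeA; ring
  calc ‖nodeA t‖ ≤ ‖t‖ ^ 2 + ‖nodalParam - 1‖ := by
        rw [h, ← norm_pow]; exact norm_add_le _ _
    _ ≤ 10 ^ 2 + 1 := by gcongr; exact norm_nodalParam_sub_one_le
    _ = 101 := by norm_num

theorem norm_nodeB_le {t : ℂ} (ht : ‖t‖ ≤ 10) : ‖nodeB t‖ ≤ 110 + 1 / 100 := by
  calc ‖nodeB t‖ ≤ ‖t‖ ^ 2 + ‖t‖ + ‖nodalParam‖ := by
        rw [← norm_pow]; exact norm_add₃_le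
    _ ≤ 10 ^ 2 + 10 + 1 / 100 := by gcongr; exact norm_nodalParam_le
    _ = _ := by norm_num

theorem nodeC_eq_nodeB_neg (t : ℂ) : nodeC t = nodeB (-t) := by
  unfold nodeB nodeC; ring

theorem norm_nodeC_le {t : ℂ} (ht : ‖t‖ ≤ 10) : ‖nodeC t‖ ≤ 110 + 1 / 100 := by
  rw [nodeC_eq_nodeB_neg]; exact norm_nodeB_le (by rwa [norm_neg])

theorem le_norm_nodeA {t : ℂ} (ht : ‖t‖ = 10) : 99 ≤ ‖nodeA t‖ := by
  have h : nodeA t = t ^ 2 + (nodalParam - 1) := by unfold nodeA; ring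
  have h1 := norm_sub_le_norm_add (t ^ 2) (nodalParam - 1)
  rw [norm_pow, ht, ← h] at h1
  linarith [norm_nodalParam_sub_one_le]

theorem le_norm_nodeB {t : ℂ} (ht : ‖t‖ = 10) : 89 ≤ ‖nodeB t‖ := by
  have h : nodeB t = t ^ 2 + (t + nodalParam) := by unfold nodeB; ring
  have h1 := norm_sub_le_norm_add (t ^ 2) (t + nodalParam)
  rw [norm_pow, ht, ← h] at h1
  have h2 := norm_add_le t nodalParam
  have h3 := norm_nodalParam_le
  linarith

theorem le_norm_nodeC {t : ℂ} (ht : ‖t‖ = 10) : 89 ≤ ‖nodeC t‖ := by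
  rw [nodeC_eq_nodeB_neg]; exact le_norm_nodeB (by rwa [norm_neg])

theorem node_identity (t : ℂ) :
    nodeA t * nodeC t + nodeA t * nodeB t - 2 * (nodeB t * nodeC t) = -2 * nodalParam := by
  unfold nodeA nodeB nodeC; ring

theorem differentiable_nodeA : Differentiable ℂ nodeA := by unfold nodeA; fun_prop
theorem differentiable_nodeB : Differentiable ℂ nodeB := by unfold nodeB; fun_prop
theorem differentiable_nodeC : Differentiable ℂ nodeC := by unfold nodeC; fun_prop

theorem differentiable_nodalQuartic : Differentiable ℂ nodalQuartic := by
  rw [differentiable_euclidean]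
  have := differentiable_nodeA
  have := differentiable_nodeB
  have := differentiable_nodeC
  intro i
  fin_cases i <;> simp [nodalQuartic] <;> fun_prop

theorem nodalQuartic_mem_ball {t : ℂ} (ht : ‖t‖ ≤ 10) : nodalQuartic t ∈ ball 0 1 := by
  rw [mem_ball_zero_iff]
  refine lt_of_pow_lt_pow_left₀ 2 zero_le_one ?_
  have hA := norm_nodeA_le ht
  have hB := norm_nodeB_le ht
  have hC := norm_nodeC_le ht
  unfold nodalQuartic
  rw [EuclideanSpace.norm_pair_sq]
  simp only [norm_mul, norm_div, norm_one]
  norm_num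
  calc _ ≤ (1 / 16000 * (101 * (110 + 1 / 100))) ^ 2
        + (1 / 16000 * (101 * (110 + 1 / 100)) : ℝ) ^ 2 := by gcongr
    _ < 1 := by norm_num

theorem nodalQuartic_sub_nodeB (t : ℂ) : nodalQuartic t - !₂[nodeCoord, 0] =
    !₂[1 / 16000 * (nodeB t * (2 * nodeC t - nodeA t)), 1 / 16000 * (nodeB t * nodeA t)] := by
  have h := node_identity t
  ext i
  fin_cases i
  · simp only [nodalQuartic, nodeCoord, PiLp.sub_apply]
    simp
    linear_combination 1 / 16000 * h
  · simp [nodalQuartic, mul_comm]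

theorem nodalQuartic_sub_nodeC (t : ℂ) : nodalQuartic t - !₂[0, nodeCoord] =
    !₂[1 / 16000 * (nodeC t * nodeA t), 1 / 16000 * (nodeC t * (2 * nodeB t - nodeA t))] := by
  have h := node_identity t
  ext i
  fin_cases i
  · simp [nodalQuartic, mul_comm]
  · simp only [nodalQuartic, nodeCoord, PiLp.sub_apply]
    simp
    linear_combination 1 / 16000 * h

theorem norm_pair_le_of_factor {q a c : ℂ} (ha : ‖a‖ ≤ 1000) (hc : ‖c‖ ≤ 1000) :
    ‖(!₂[1 / 16000 * (q * a), 1 / 16000 * (q * c)] : EuclideanSpace ℂ (Fin 2))‖ ≤ ‖q‖ := by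
  refine (EuclideanSpace.norm_pair_le _ _).trans ?_
  simp only [norm_mul, norm_div, norm_one]
  norm_num
  have h1 : ‖q‖ * ‖a‖ ≤ ‖q‖ * 1000 := by gcongr
  have h2 : ‖q‖ * ‖c‖ ≤ ‖q‖ * 1000 := by gcongr
  linarith [norm_nonneg q]

theorem norm_two_mul_sub_le {x y : ℂ} (hx : ‖x‖ ≤ 110 + 1 / 100) (hy : ‖y‖ ≤ 101) :
    ‖2 * x - y‖ ≤ 1000 := by
  calc _ ≤ ‖2 * x‖ + ‖y‖ := norm_sub_le _ _
    _ ≤ _ := by rw [norm_mul]; norm_num; linarith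

/-- Near each of its three nodes, the distance of the quartic to that node is controlled by the
product of the three node polynomials. -/
theorem exists_node_dist_le {t : ℂ} (ht : ‖t‖ ≤ 10) :
    ∃ a ∈ ({0, !₂[nodeCoord, 0], !₂[0, nodeCoord]} : Set (EuclideanSpace ℂ (Fin 2))),
      ‖nodalQuartic t - a‖ ≤ 2 * 10 ^ 14 * ‖nodeA t * nodeB t * nodeC t‖ := by
  have hA := norm_nodeA_le ht
  have hB := norm_nodeB_le ht
  have hC := norm_nodeC_le ht
  have dA : ‖nodalQuartic t - 0‖ ≤ ‖nodeA t‖ := by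
    rw [sub_zero]
    exact norm_pair_le_of_factor (by linarith) (by linarith)
  have dB : ‖nodalQuartic t - !₂[nodeCoord, 0]‖ ≤ ‖nodeB t‖ := by
    rw [nodalQuartic_sub_nodeB]
    exact norm_pair_le_of_factor (norm_two_mul_sub_le hC hA) (by linarith)
  have dC : ‖nodalQuartic t - !₂[0, nodeCoord]‖ ≤ ‖nodeC t‖ := by
    rw [nodalQuartic_sub_nodeC]
    exact norm_pair_le_of_factor (by linarith) (norm_two_mul_sub_le hB hA)
  have hid : 2 / 10 ^ 14 ≤ ‖nodeA t * nodeC t‖ + ‖nodeA t * nodeB t‖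
      + 2 * ‖nodeB t * nodeC t‖ := by
    calc (2 / 10 ^ 14 : ℝ) = ‖nodeA t * nodeC t + nodeA t * nodeB t
          - 2 * (nodeB t * nodeC t)‖ := by rw [node_identity]; norm_num [nodalParam]
      _ ≤ ‖nodeA t * nodeC t + nodeA t * nodeB t‖ + ‖2 * (nodeB t * nodeC t)‖ := norm_sub_le _ _
      _ ≤ _ := by
        have : ‖2 * (nodeB t * nodeC t)‖ = 2 * ‖nodeB t * nodeC t‖ := by rw [norm_mul]; norm_num
        rw [this]
        gcongr
        exact norm_add_le _ _
  have aux : ∀ x y : ℝ, 0 ≤ y → 1 / (2 * 10 ^ 14) ≤ x → y ≤ 2 * 10 ^ 14 * (x * y) := by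
    intro x y hy hx
    rw [div_le_iff₀ (by positivity)] at hx
    nlinarith
  have key : 1 / (2 * 10 ^ 14) ≤ ‖nodeB t * nodeC t‖ ∨ 1 / (2 * 10 ^ 14) ≤ ‖nodeA t * nodeC t‖ ∨
      1 / (2 * 10 ^ 14) ≤ ‖nodeA t * nodeB t‖ := by
    by_contra! h
    norm_num at h hid
    linarith [h.1, h.2.1, h.2.2]
  rcases key with h | h | h
  · refine ⟨0, by simp, dA.trans ((aux _ _ (norm_nonneg _) h).trans_eq ?_)⟩
    simp only [norm_mul]; ring
  · refine ⟨_, by simp, dB.trans ((aux _ _ (norm_nonneg _) h).trans_eq ?_)⟩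
    simp only [norm_mul]; ring
  · refine ⟨_, by simp, dC.trans ((aux _ _ (norm_nonneg _) h).trans_eq ?_)⟩
    simp only [norm_mul]

theorem norm_node_product_base :
    0 < ‖nodeA (51 / 50) * nodeB (51 / 50) * nodeC (51 / 50)‖ ∧
    ‖nodeA (51 / 50) * nodeB (51 / 50) * nodeC (51 / 50)‖ / 784179 ≤ 3 / 10 ^ 9 := by
  have h : nodeA (51 / 50) * nodeB (51 / 50) * nodeC (51 / 50) =
      (((101 / 2500 + 1 / 10 ^ 14) * (5151 / 2500 + 1 / 10 ^ 14) * (51 / 2500 + 1 / 10 ^ 14) : ℝ)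
        : ℂ) := by
    unfold nodeA nodeB nodeC nodalParam
    push_cast
    norm_num
  rw [h, Complex.norm_real, Real.norm_of_nonneg (by positivity)]
  norm_num

/-- Upper bound for the Green function with poles at the nodes of the quartic. -/
theorem greenFunction_nodal_le {S : Finset (EuclideanSpace ℂ (Fin 2))}
    (hS : ({0, !₂[nodeCoord, 0], !₂[0, nodeCoord]} : Set (EuclideanSpace ℂ (Fin 2))) ⊆ S) :
    greenFunction (ball 0 1) S (nodalQuartic (51 / 50)) ≤ (Real.log (3 / 10 ^ 9) : ℝ) := by
  refine sSup_le ?_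
  rintro _ ⟨u, hu, hu0, hpole, rfl⟩
  obtain ⟨hpos, hle⟩ := norm_node_product_base
  choose! c hc using hpole
  set C : ℝ := |c 0| + |c !₂[nodeCoord, 0]| + |c !₂[0, nodeCoord]| with hC
  have hcC : ∀ a ∈ ({0, !₂[nodeCoord, 0], !₂[0, nodeCoord]} : Set (EuclideanSpace ℂ (Fin 2))),
      c a ≤ C := by
    have h1 := le_abs_self (c 0)
    have h2 := le_abs_self (c !₂[nodeCoord, 0])
    have h3 := le_abs_self (c !₂[0, nodeCoord])
    have h4 := abs_nonneg (c 0)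
    have h5 := abs_nonneg (c !₂[nodeCoord, 0])
    have h6 := abs_nonneg (c !₂[0, nodeCoord])
    rintro a (rfl | rfl | rfl) <;> linarith
  have := differentiable_nodeA
  have := differentiable_nodeB
  have := differentiable_nodeC
  have hmain := hu.le_log_norm_div isOpen_ball hu0 differentiable_nodalQuartic
    (P := fun t => nodeA t * nodeB t * nodeC t) (R := 10) (m := 784179)
    (C := Real.log (2 * 10 ^ 14) + C) (t₀ := 51 / 50)
    (by fun_prop) (by norm_num)
    (fun t ht => nodalQuartic_mem_ball (mem_closedBall_zero_iff.1 ht))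
    (fun t ht => by
      have ht' := mem_sphere_zero_iff_norm.1 ht
      have h1 := le_norm_nodeA ht'
      have h2 := le_norm_nodeB ht'
      have h3 := le_norm_nodeC ht'
      simp only [norm_mul]
      calc (784179 : ℝ) = 99 * 89 * 89 := by norm_num
        _ ≤ _ := by gcongr)
    (fun t ht hPt => by
      have ht' := mem_closedBall_zero_iff.1 ht
      obtain ⟨a, ha, hd⟩ := exists_node_dist_le ht'
      have hp : 0 < ‖nodeA t * nodeB t * nodeC t‖ := norm_pos_iff.2 hPt
      refine (hc a (hS ha) _ (nodalQuartic_mem_ball ht')).trans ?_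
      have h1 := ENNReal.log_enorm_le (by positivity) hd
      rw [Real.log_mul (by positivity) hp.ne'] at h1
      calc _ ≤ ((Real.log (2 * 10 ^ 14) + Real.log ‖nodeA t * nodeB t * nodeC t‖ : ℝ) : EReal)
            + ((C : ℝ) : EReal) := add_le_add h1 (EReal.coe_le_coe_iff.2 (hcC a ha))
        _ = _ := by rw [← EReal.coe_add, EReal.coe_eq_coe_iff]; ring)
    (by rw [mem_closedBall_zero_iff]; norm_num) (norm_pos_iff.1 hpos)
  refine hmain.trans (EReal.coe_le_coe_iff.2 (Real.log_le_log ?_ hle))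
  exact div_pos hpos (by norm_num)

theorem nodeCoord_ne_zero : nodeCoord ≠ 0 := by norm_num [nodeCoord, nodalParam]

theorem norm_nodeCoord : ‖nodeCoord‖ = 1 / (8 * 10 ^ 17) := by
  norm_num [nodeCoord, nodalParam]

/-- Lower bound for the parameters of a disk in the unit ball through the nodes of the quartic. -/
theorem le_prod_norm_of_disk_through_nodes {φ : ℂ → EuclideanSpace ℂ (Fin 2)} {x y w : ℂ}
    (hφ : DifferentiableOn ℂ φ (ball 0 1)) (hmaps : MapsTo φ (ball 0 1) (ball 0 1))
    (h0 : φ 0 = nodalQuartic (51 / 50))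
    (hx : x ∈ ball (0 : ℂ) 1) (hy : y ∈ ball (0 : ℂ) 1) (hw : w ∈ ball (0 : ℂ) 1)
    (hφx : φ x = 0) (hφy : φ y = !₂[nodeCoord, 0]) (hφw : φ w = !₂[0, nodeCoord]) :
    4 / 10 ^ 9 ≤ ‖x‖ * ‖y‖ * ‖w‖ := by
  have hcoord := differentiableOn_euclidean.1 hφ
  have hbd : ∀ i, MapsTo (fun t => φ t i) (ball 0 1) (closedBall 0 1) := by
    intro i t ht
    have h1 := mem_ball_zero_iff.1 (hmaps ht)
    exact mem_closedBall_zero_iff.2 ((PiLp.norm_apply_le (φ t) i).trans h1.le)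
  have hf0 : φ 0 0 = (((1 / 16000) * ((101 / 2500 + 1 / 10 ^ 14) * (51 / 2500 + 1 / 10 ^ 14)) : ℝ)
      : ℂ) := by
    simp [h0, nodalQuartic, nodeA, nodeC, nodalParam]
    norm_num
  have hg0 : φ 0 1 = (((1 / 16000) * ((101 / 2500 + 1 / 10 ^ 14) * (5151 / 2500 + 1 / 10 ^ 14))
      : ℝ) : ℂ) := by
    simp [h0, nodalQuartic, nodeA, nodeB, nodalParam]
    norm_num
  have hsum : φ 0 0 + φ 0 1 - nodeCoord = (((1 / 16000) * ((101 / 2500 + 1 / 10 ^ 14) *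
      (51 / 2500 + 1 / 10 ^ 14)) + (1 / 16000) * ((101 / 2500 + 1 / 10 ^ 14) *
      (5151 / 2500 + 1 / 10 ^ 14)) + 1 / (8 * 10 ^ 17) : ℝ) : ℂ) := by
    rw [hf0, hg0]
    simp [nodeCoord, nodalParam]
    norm_num
  have hfn : ‖φ 0 0‖ = (1 / 16000) * ((101 / 2500 + 1 / 10 ^ 14) * (51 / 2500 + 1 / 10 ^ 14)) := by
    rw [hf0, Complex.norm_real, Real.norm_of_nonneg (by positivity)]
  have hgn : ‖φ 0 1‖ =
      (1 / 16000) * ((101 / 2500 + 1 / 10 ^ 14) * (5151 / 2500 + 1 / 10 ^ 14)) := by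
    rw [hg0, Complex.norm_real, Real.norm_of_nonneg (by positivity)]
  have hsn : ‖φ 0 0 + φ 0 1 - nodeCoord‖ = (1 / 16000) * ((101 / 2500 + 1 / 10 ^ 14) *
      (51 / 2500 + 1 / 10 ^ 14)) + (1 / 16000) * ((101 / 2500 + 1 / 10 ^ 14) *
      (5151 / 2500 + 1 / 10 ^ 14)) + 1 / (8 * 10 ^ 17) := by
    rw [hsum, Complex.norm_real, Real.norm_of_nonneg (by positivity)]
  have hmain := disk_through_three_points (η := 1 / 10 ^ 8) (σ := 1 / 10 ^ 4) (q := 22 / 10 ^ 4)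
    (hcoord 0) (hcoord 1) (hbd 0) (hbd 1) hx hy hw
    nodeCoord_ne_zero (by rw [norm_nodeCoord]; norm_num) (by norm_num) (by norm_num)
    (by rw [norm_nodeCoord]; norm_num) (by simp [hφx]) (by simp [hφy]) (by simp [hφw])
    (by simp [hφx]) (by simp [hφy]) (by simp [hφw]) (by norm_num) (by rw [hgn]; norm_num)
  rw [hfn, hgn, hsn] at hmain
  generalize ‖x‖ * ‖y‖ * ‖w‖ = p at hmain ⊢
  rcases hmain with h | h | h | h <;> norm_num at h ⊢ <;> linarith

end

theorem theorem1 :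
    ∃ S : Finset (EuclideanSpace ℂ (Fin 2)),
      S.card = 3 ∧ (S : Set (EuclideanSpace ℂ (Fin 2))) ⊆ ball 0 1 ∧
      ∃ z ∈ ball (0 : EuclideanSpace ℂ (Fin 2)) 1,
        lempertFunction (ball 0 1) S z > greenFunction (ball 0 1) S z := by
  classical
  have hne := nodeCoord_ne_zero
  have h12 : (0 : EuclideanSpace ℂ (Fin 2)) ≠ !₂[nodeCoord, 0] := fun h =>
    hne (by simpa using (congrArg (fun v : EuclideanSpace ℂ (Fin 2) => v 0) h).symm)
  have h13 : (0 : EuclideanSpace ℂ (Fin 2)) ≠ !₂[0, nodeCoord] := fun h =>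
    hne (by simpa using (congrArg (fun v : EuclideanSpace ℂ (Fin 2) => v 1) h).symm)
  have h23 : (!₂[nodeCoord, 0] : EuclideanSpace ℂ (Fin 2)) ≠ !₂[0, nodeCoord] := fun h =>
    hne (by simpa using congrArg (fun v : EuclideanSpace ℂ (Fin 2) => v 0) h)
  refine ⟨{0, !₂[nodeCoord, 0], !₂[0, nodeCoord]}, ?_, ?_, nodalQuartic (51 / 50),
    nodalQuartic_mem_ball (by norm_num), ?_⟩
  · exact Finset.card_eq_three.2 ⟨_, _, _, h12, h13, h23, rfl⟩
  · have hlt : ‖nodeCoord‖ < 1 := by rw [norm_nodeCoord]; norm_num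
    intro a ha
    simp only [Finset.coe_insert, Finset.coe_singleton, mem_insert_iff, mem_singleton_iff] at ha
    rw [mem_ball_zero_iff]
    rcases ha with rfl | rfl | rfl
    · simp
    · exact (EuclideanSpace.norm_pair_le _ _).trans_lt (by simpa using hlt)
    · exact (EuclideanSpace.norm_pair_le _ _).trans_lt (by simpa using hlt)
  · refine (greenFunction_nodal_le (by simp)).trans_lt ?_
    refine (EReal.coe_lt_coe_iff.2 (Real.log_lt_log (by norm_num)
      (show (3 / 10 ^ 9 : ℝ) < 4 / 10 ^ 9 by norm_num))).trans_le ?_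
    refine le_sInf ?_
    rintro _ ⟨φ, ζ, hφ, hmaps, h0, hζ, rfl⟩
    obtain ⟨m1, v1⟩ := hζ 0 (by simp)
    obtain ⟨m2, v2⟩ := hζ !₂[nodeCoord, 0] (by simp)
    obtain ⟨m3, v3⟩ := hζ !₂[0, nodeCoord] (by simp)
    have hp := le_prod_norm_of_disk_through_nodes hφ hmaps h0 m1 m2 m3 v1 v2 v3
    rw [Finset.sum_insert (by simp [h12, h13]), Finset.sum_insert (by simp [h23]),
      Finset.sum_singleton, ← add_assoc, ← ENNReal.log_mul_add, ← ENNReal.log_mul_add,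
      ← enorm_mul, ← enorm_mul]
    exact ENNReal.le_log_enorm (by norm_num) (by simpa only [norm_mul] using hp)
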